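/- Let $G_1,\dots,G_5$ be finite sets of bosonic modes, with $G_1,G_2$ non-empty and $|G_4|=|G_2|$; modes of $G_4$ are identified with those of $G_2$. For a set $G$ of modes let $\mathcal H_N(G)$ be the Hilbert space of $N$ bosons in $G$, with orthonormal basis the Fock states $|n\rangle$, $n\colon G\to\mathbb N$, $\sum_{i\in G}n_i=N$. Alice holds the modes $G_1\cup G_2\cup G_3$ and Bob holds $G_4\cup G_5$; particle reservoirs and ancillary modes that the parties use are included in $G_3$ and $G_5$. Let $N\ge 1$ and $\nu\ge 0$ be integers. Let the shared resource be any density matrix $\rho$ of at most $\nu$ bosons in $G_3\cup G_4\cup G_5$ which commutes with the total particle number operator. Let $\mathcal T$ be any LOCC protocol between Alice and Bob: in each of finitely many rounds one party performs a trace-preserving generalized measurement with finitely many outcomes, whose Kraus operators act on that party's modes and commute with that party's total particle number operator, and announces the outcome, on which all later steps may depend. (In particular the protocol may leave $G_1$ untouched.) For a unit vector $\psi\in\mathcal H_N(G_1\cup G_2)$ let $\mathcal T[|\psi\rangle\langle\psi|]$ be the state of the modes $G_1\cup G_4$ obtained by applying the protocol to $|\psi\rangle\langle\psi|\otimes\rho$,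 averaging over all outcomes and tracing out $G_2,G_3,G_5$. Then the function $\psi\mapsto\langle\psi|\mathcal T[|\psi\rangle\langle\psi|]|\psi\rangle$, where in the overlap $\psi$ is regarded as a vector of $\mathcal H_N(G_1\cup G_4)$, is integrable and the average teleportation fidelity satisfies $$f=\int d\psi\,\langle\psi|\mathcal T[|\psi\rangle\langle\psi|]|\psi\rangle<1,$$ where $d\psi$ is the uniform (unitarily invariant) probability distribution on the unit sphere of $\mathcal H_N(G_1\cup G_2)$. That is, deterministic perfect teleportation with fidelity one is impossible for any fixed, finite number of identical bosons. -/

import Mathlib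

open MeasureTheory
open scoped Kronecker ComplexOrder

namespace BosonTeleport

noncomputable section

/-! ### Bosonic modes -/

/-- Total number of particles of an occupation `n` of the modes `M`. -/
def total {M : Type*} [Fintype M] (n : M → ℕ) : ℕ := ∑ i, n i

/-- Fock states of exactly `N` bosons in the modes `M`: the orthonormal basis of the
`N`-particle Hilbert space, so that its vectors are `EuclideanSpace ℂ (Sector M N)`. -/
def Sector (M : Type*) [Fintype M] (N : ℕ) : Type _ := {n : M → ℕ // total n = N}

/-- Fock states of at most `L` bosons in the modes `M`. -/
def Fock (M : Type*) [Fintype M] (L : ℕ) : Type _ := {n : M → ℕ // total n ≤ L}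

instance instDecidableEqSector (M : Type*) [Fintype M] (N : ℕ) : DecidableEq (Sector M N) :=
  inferInstanceAs (DecidableEq {n : M → ℕ // total n = N})

instance instDecidableEqFock (M : Type*) [Fintype M] (L : ℕ) : DecidableEq (Fock M L) :=
  inferInstanceAs (DecidableEq {n : M → ℕ // total n ≤ L})

instance instFiniteFock (M : Type*) [Fintype M] (L : ℕ) : Finite (Fock M L) := by
  refine Finite.of_injective
    (fun n : Fock M L => fun i : M => (⟨n.1 i, Nat.lt_succ_of_le
      ((Finset.single_le_sum (fun _ _ => Nat.zero_le _) (Finset.mem_univ i)).trans n.2)⟩ :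
        Fin (L + 1))) ?_
  intro n m h
  apply Subtype.ext
  funext i
  exact congrArg Fin.val (congrFun h i)

instance instFiniteSector (M : Type*) [Fintype M] (N : ℕ) : Finite (Sector M N) :=
  Finite.of_injective (β := Fock M N) (fun n => ⟨n.1, n.2.le⟩)
    (fun _ _ h => Subtype.ext (congrArg (fun n : Fock M N => n.1) h))

instance instFintypeFock (M : Type*) [Fintype M] (L : ℕ) : Fintype (Fock M L) :=
  Fintype.ofFinite _

instance instFintypeSector (M : Type*) [Fintype M] (N : ℕ) : Fintype (Sector M N) :=
  Fintype.ofFinite _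

/-- Operators on the space of at most `L` bosons in the modes `M`, as matrices in the Fock basis. -/
abbrev Op (M : Type*) [Fintype M] (L : ℕ) := Matrix (Fock M L) (Fock M L) ℂ

/-- The total particle number operator of the modes `M`. -/
def numberOp (M : Type*) [Fintype M] (L : ℕ) : Op M L :=
  Matrix.diagonal fun n => (total n.1 : ℂ)

/-- A state (density matrix) of at most `ν` bosons that obeys the particle-number superselection
rule: a mixture of states each of which has a definite total number of particles. -/
structure IsState {M : Type*} [Fintype M] {ν : ℕ} (ρ : Op M ν) : Prop where
  posSemidef : ρ.PosSemidef
  trace_eq_one : ρ.trace = 1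
  commute : Commute ρ (numberOp M ν)

/-- Amplitude of the `N`-particle vector `ψ` on an occupation `n`; it is zero if `n` does not have
`N` particles. -/
def amplitude {M : Type*} [Fintype M] {N : ℕ} (ψ : EuclideanSpace ℂ (Sector M N))
    (n : M → ℕ) : ℂ :=
  if h : total n = N then ψ ⟨n, h⟩ else 0

/-- Matrix element `⟨n|ρ|m⟩`; it is zero if `n` or `m` has more than `ν` particles. -/
def entry {M : Type*} [Fintype M] {ν : ℕ} (ρ : Op M ν) (n m : M → ℕ) : ℂ :=
  if h : total n ≤ ν ∧ total m ≤ ν then ρ ⟨n, h.1⟩ ⟨m, h.2⟩ else 0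

/-! ### Local operations and classical communication -/

/-- Kraus operators of a complete (trace-preserving) generalized measurement, each of which
conserves the number of particles in the modes `M`. Unitary operations (one outcome) and projective
measurements are special cases. -/
structure IsMeasurement {M : Type*} [Fintype M] {L r : ℕ} (K : Fin r → Op M L) : Prop where
  commute : ∀ i, Commute (K i) (numberOp M L)
  complete : ∑ i, (K i).conjTranspose * K i = 1

/-- A particle-conserving LOCC protocol between Alice (modes `A`) and Bob (modes `B`), with any
finite number of rounds: in each round one of them performs a local measurement and announces
the outcome, on which the rest of the protocol may depend. -/
inductive LOCC (A B : Type*) [Fintype A] [Fintype B] (L : ℕ) : Type _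
  | halt : LOCC A B L
  | alice (r : ℕ) (K : Fin r → Op A L) (hK : IsMeasurement K) (next : Fin r → LOCC A B L) :
      LOCC A B L
  | bob (r : ℕ) (K : Fin r → Op B L) (hK : IsMeasurement K) (next : Fin r → LOCC A B L) :
      LOCC A B L

/-- Operators on the joint space of Alice and Bob. -/
abbrev JointOp (A B : Type*) [Fintype A] [Fintype B] (L : ℕ) :=
  Matrix (Fock A L × Fock B L) (Fock A L × Fock B L) ℂ

/-- The final state of a protocol, averaged over all measurement outcomes (no post-selection). -/
def LOCC.run {A B : Type*} [Fintype A] [Fintype B] {L : ℕ} :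
    LOCC A B L → JointOp A B L → JointOp A B L
  | .halt, σ => σ
  | .alice _ K _ next, σ =>
      ∑ i, (next i).run ((K i ⊗ₖ (1 : Op B L)) * σ * (K i ⊗ₖ (1 : Op B L)).conjTranspose)
  | .bob _ K _ next, σ =>
      ∑ i, (next i).run (((1 : Op A L) ⊗ₖ K i) * σ * ((1 : Op A L) ⊗ₖ K i).conjTranspose)

/-! ### Teleportation

The modes are split into five groups. The vector `ψ` to be teleported lives on `G₁ ⊕ G₂`, the
resource on `G₃ ⊕ (G₄ ⊕ G₅)`, where `G₄` is a copy of `G₂`. Alice holds `(G₁ ⊕ G₂) ⊕ G₃` and Bob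
holds `G₄ ⊕ G₅`. The parts of a particle reservoir (and all ancillary modes) held by Alice and
Bob are part of `G₃` and `G₅`. Protocols that do not touch `G₁` are a special case.
As the total number of particles is conserved, neither party ever holds more than `N + ν`. -/

section Teleport

variable {G₁ G₂ G₃ G₅ : Type*} [Fintype G₁] [Fintype G₂] [Fintype G₃] [Fintype G₅]

/-- Occupation of `G₁ ⊕ G₂` in a joint Fock state. -/
def occ12 {L : ℕ} (p : Fock ((G₁ ⊕ G₂) ⊕ G₃) L × Fock (G₂ ⊕ G₅) L) : G₁ ⊕ G₂ → ℕ :=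
  fun i => p.1.1 (Sum.inl i)

/-- Occupation of `G₃ ⊕ (G₄ ⊕ G₅)` in a joint Fock state. -/
def occ345 {L : ℕ} (p : Fock ((G₁ ⊕ G₂) ⊕ G₃) L × Fock (G₂ ⊕ G₅) L) : G₃ ⊕ (G₂ ⊕ G₅) → ℕ :=
  Sum.elim (fun i => p.1.1 (Sum.inr i)) p.2.1

/-- Occupation of `G₁ ⊕ G₄` in a joint Fock state. -/
def occ14 {L : ℕ} (p : Fock ((G₁ ⊕ G₂) ⊕ G₃) L × Fock (G₂ ⊕ G₅) L) : G₁ ⊕ G₂ → ℕ :=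
  Sum.elim (fun i => p.1.1 (Sum.inl (Sum.inl i))) (fun i => p.2.1 (Sum.inl i))

/-- Occupation of `G₂ ⊕ (G₃ ⊕ G₅)` in a joint Fock state. -/
def occ235 {L : ℕ} (p : Fock ((G₁ ⊕ G₂) ⊕ G₃) L × Fock (G₂ ⊕ G₅) L) : G₂ ⊕ (G₃ ⊕ G₅) → ℕ :=
  Sum.elim (fun i => p.1.1 (Sum.inl (Sum.inr i)))
    (Sum.elim (fun i => p.1.1 (Sum.inr i)) (fun i => p.2.1 (Sum.inr i)))

/-- The initial state `|ψ⟩⟨ψ| ⊗ ρ`, with `ψ` on `G₁ ⊕ G₂` and `ρ` on `G₃ ⊕ (G₄ ⊕ G₅)`. -/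
def initialState {N ν : ℕ} (ψ : EuclideanSpace ℂ (Sector (G₁ ⊕ G₂) N))
    (ρ : Op (G₃ ⊕ (G₂ ⊕ G₅)) ν) : JointOp ((G₁ ⊕ G₂) ⊕ G₃) (G₂ ⊕ G₅) (N + ν) :=
  Matrix.of fun p q =>
    amplitude ψ (occ12 p) * star (amplitude ψ (occ12 q)) * entry ρ (occ345 p) (occ345 q)

/-- Partial trace over `G₂`, `G₃`, `G₅`: the matrix element `⟨x|tr₂₃₅ τ|y⟩` of the reduced state
on `G₁ ⊕ G₄`. -/
def reduced14 {L : ℕ} (τ : JointOp ((G₁ ⊕ G₂) ⊕ G₃) (G₂ ⊕ G₅) L) (x y : G₁ ⊕ G₂ → ℕ) : ℂ :=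
  ∑ p, ∑ q, if occ14 p = x ∧ occ14 q = y ∧ occ235 p = occ235 q then τ p q else 0

/-- The overlap `⟨ψ₁₄| T[|ψ⟩⟨ψ|] |ψ₁₄⟩` of the averaged teleported state on `G₁ ⊕ G₄` with the
ideally teleported vector. -/
def overlap {N ν : ℕ} (ρ : Op (G₃ ⊕ (G₂ ⊕ G₅)) ν)
    (P : LOCC ((G₁ ⊕ G₂) ⊕ G₃) (G₂ ⊕ G₅) (N + ν))
    (ψ : EuclideanSpace ℂ (Sector (G₁ ⊕ G₂) N)) : ℝ :=
  (∑ x : Sector (G₁ ⊕ G₂) N, ∑ y : Sector (G₁ ⊕ G₂) N,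
    star (ψ x) * reduced14 (P.run (initialState ψ ρ)) x.1 y.1 * ψ y).re

end Teleport

/-- The uniform distribution `dψ` over the `N`-particle state vectors of the modes `M`: the
normalized (unitarily invariant) surface measure on the unit sphere. -/
def uniform (M : Type*) [Fintype M] (N : ℕ) :
    Measure (Metric.sphere (0 : EuclideanSpace ℂ (Sector M N)) 1) :=
  ((volume : Measure (EuclideanSpace ℂ (Sector M N))).toSphere Set.univ)⁻¹ •
    (volume : Measure (EuclideanSpace ℂ (Sector M N))).toSphere

/-- The teleportation fidelity: the mean overlap over all `N`-particle state vectors of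
`G₁ ⊕ G₂`. -/
def fidelity {G₁ G₂ G₃ G₅ : Type*} [Fintype G₁] [Fintype G₂] [Fintype G₃] [Fintype G₅] {N ν : ℕ}
    (ρ : Op (G₃ ⊕ (G₂ ⊕ G₅)) ν) (P : LOCC ((G₁ ⊕ G₂) ⊕ G₃) (G₂ ⊕ G₅) (N + ν)) : ℝ :=
  ∫ ψ, overlap ρ P ψ.1 ∂(uniform (G₁ ⊕ G₂) N)

end

end BosonTeleport

/-! The obstruction is conservation of Alice's mean particle number. Averaged over outcomes, a
protocol has Kraus operators commuting with that number (`LOCC.exists_kraus`). Her mean number at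
the end therefore equals its initial value, `N` plus the resource's mean number in `G₃`, whatever
`ψ` is.

Splitting `ρ` into rank-one terms gives finitely many vectors `U j ψ`, linear in `ψ`, whose squared
norms sum to one on unit vectors (`exists_overlap_eq`). If the overlap were one for every unit `ψ`,
equality in Cauchy–Schwarz would make each `U j ψ` a product of `ψ` on `G₁ ⊕ G₄` with a vector on
the traced modes. By linearity this second factor cannot depend on `ψ`, since a linear map having
every vector as an eigenvector is a scalar. Alice's final mean number is then the number in `G₁` of
a basis state plus a constant (`sum_add_mul_norm_sq_eq`). Putting all `N` bosons in `G₁` or all in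
`G₂` changes it by `N ≥ 1`, a contradiction.

So some overlap differs from one. As overlaps are continuous and at most one, and the uniform
measure charges every nonempty open set, the average lies strictly below one. -/

namespace BosonTeleport

/-! ### Kraus representations and conserved mean values -/

section Kraus

variable {A B : Type*} [Fintype A] [Fintype B] {L : ℕ}

/-- The averaged action of a particle-conserving LOCC protocol has a Kraus representation whose
operators commute with the first party's particle number. -/
theorem LOCC.exists_kraus (P : LOCC A B L) :
    ∃ (ι : Type) (_ : Fintype ι) (K : ι → JointOp A B L),
      (∀ i, Commute (K i) (numberOp A L ⊗ₖ (1 : Op B L))) ∧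
      ∑ i, (K i).conjTranspose * K i = 1 ∧
      ∀ σ, P.run σ = ∑ i, K i * σ * (K i).conjTranspose := by
  classical
  -- Compose a first measurement `M` with Kraus representations of the continuations.
  have step : ∀ {r : ℕ} (M : Fin r → JointOp A B L) (next : Fin r → LOCC A B L),
      (∀ i, Commute (M i) (numberOp A L ⊗ₖ (1 : Op B L))) →
      ∑ i, (M i).conjTranspose * M i = 1 →
      (∀ i, ∃ (ι : Type) (_ : Fintype ι) (K : ι → JointOp A B L),
        (∀ i, Commute (K i) (numberOp A L ⊗ₖ (1 : Op B L))) ∧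
        ∑ i, (K i).conjTranspose * K i = 1 ∧
        ∀ σ, (next i).run σ = ∑ i, K i * σ * (K i).conjTranspose) →
      ∃ (ι : Type) (_ : Fintype ι) (K : ι → JointOp A B L),
        (∀ i, Commute (K i) (numberOp A L ⊗ₖ (1 : Op B L))) ∧
        ∑ i, (K i).conjTranspose * K i = 1 ∧
        ∀ σ, ∑ i, (next i).run (M i * σ * (M i).conjTranspose) =
          ∑ i, K i * σ * (K i).conjTranspose := by
    intro r M next hM hsum ih
    choose ι hι K hc hs hr using ih
    refine ⟨Σ i, ι i, inferInstance, fun s => K s.1 s.2 * M s.1,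
      fun s => (hc s.1 s.2).mul_left (hM s.1), ?_, fun σ => ?_⟩
    · rw [Fintype.sum_sigma, ← hsum]
      refine Finset.sum_congr rfl fun i _ => ?_
      calc ∑ k, (K i k * M i).conjTranspose * (K i k * M i)
          = (M i).conjTranspose * (∑ k, (K i k).conjTranspose * K i k) * M i := by
            simp only [Matrix.conjTranspose_mul, Finset.mul_sum, Finset.sum_mul, Matrix.mul_assoc]
        _ = _ := by rw [hs i, Matrix.mul_one]
    · rw [Fintype.sum_sigma]
      refine Finset.sum_congr rfl fun i _ => ?_
      rw [hr i]
      simp only [Matrix.conjTranspose_mul, Matrix.mul_assoc]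
  induction P with
  | halt =>
    exact ⟨Unit, inferInstance, fun _ => 1, fun _ => Commute.one_left _, by simp,
      fun σ => by simp [LOCC.run]⟩
  | alice r K hK next ih =>
    refine step (fun i => K i ⊗ₖ (1 : Op B L)) next (fun i => ?_) ?_ ih
    · simp only [Commute, SemiconjBy, ← Matrix.mul_kronecker_mul, (hK.commute i).eq]
    · simp only [Matrix.conjTranspose_kronecker, ← Matrix.mul_kronecker_mul,
        Matrix.conjTranspose_one, Matrix.one_mul]
      rw [← Matrix.one_kronecker_one, ← hK.complete]
      ext p q
      simp only [Matrix.sum_apply, Matrix.kroneckerMap_apply, Finset.sum_mul]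
  | bob r K hK next ih =>
    refine step (fun i => (1 : Op A L) ⊗ₖ K i) next (fun i => ?_) ?_ ih
    · simp only [Commute, SemiconjBy, ← Matrix.mul_kronecker_mul, Matrix.one_mul, Matrix.mul_one]
    · simp only [Matrix.conjTranspose_kronecker, ← Matrix.mul_kronecker_mul,
        Matrix.conjTranspose_one, Matrix.one_mul]
      rw [← Matrix.one_kronecker_one, ← hK.complete]
      ext p q
      simp only [Matrix.sum_apply, Matrix.kroneckerMap_apply, Finset.mul_sum]

/-- A complete family of Kraus operators that commute with a real diagonal observable preserves
its expectation value. -/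
theorem sum_mul_norm_sq_mulVec {ι n : Type*} [Fintype ι] [Fintype n] [DecidableEq n]
    (K : ι → Matrix n n ℂ) (hK : ∑ i, (K i).conjTranspose * K i = 1) (d : n → ℝ)
    (hd : ∀ i, Commute (K i) (Matrix.diagonal fun p => (d p : ℂ))) (w : n → ℂ) :
    ∑ i, ∑ p, d p * ‖(K i).mulVec w p‖ ^ 2 = ∑ p, d p * ‖w p‖ ^ 2 := by
  have key : ∀ v : n → ℂ, ((∑ p, d p * ‖v p‖ ^ 2 : ℝ) : ℂ) =
      star v ⬝ᵥ (Matrix.diagonal fun p => (d p : ℂ)).mulVec v := by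
    intro v
    simp only [dotProduct, Matrix.mulVec_diagonal, Complex.ofReal_sum, Complex.ofReal_mul,
      Complex.ofReal_pow, ← Complex.conj_mul', Pi.star_apply, starRingEnd_apply]
    exact Finset.sum_congr rfl fun p _ => by ring
  apply Complex.ofReal_injective
  rw [Complex.ofReal_sum, key]
  simp only [key]
  set D : Matrix n n ℂ := Matrix.diagonal fun p => (d p : ℂ)
  -- Commutation turns `(K i)† D (K i)` into `(K i)† (K i) D`, so completeness removes the Kraus
  -- operators.
  calc ∑ i, star ((K i).mulVec w) ⬝ᵥ D.mulVec ((K i).mulVec w)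
      = ∑ i, star w ⬝ᵥ ((K i).conjTranspose * K i * D).mulVec w := by
        refine Finset.sum_congr rfl fun i _ => ?_
        rw [Matrix.star_mulVec, ← Matrix.dotProduct_mulVec, Matrix.mulVec_mulVec,
          Matrix.mulVec_mulVec, Matrix.mul_assoc, ← (hd i).eq, Matrix.mul_assoc]
    _ = star w ⬝ᵥ ((∑ i, (K i).conjTranspose * K i) * D).mulVec w := by
        rw [Finset.sum_mul, Matrix.sum_mulVec, dotProduct_sum]
    _ = _ := by rw [hK, Matrix.one_mul]

end Kraus

/-! ### Bipartite vectors and rigidity of perfect overlap -/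

section Bipartite

variable {X J S α β : Type*} [Fintype J] [Fintype S] [DecidableEq α] [DecidableEq β]
  {a : S → α} {b : S → β}

/-- Coefficient of a vector on `S` at the label `(x, z)`, for labels `a p`, `b p` of the points. -/
def coeff (a : S → α) (b : S → β) (u : S → ℂ) (x : α) (z : β) : ℂ :=
  ∑ p, if a p = x ∧ b p = z then u p else 0

theorem coeff_apply (hab : ∀ p q, a p = a q → b p = b q → p = q) (u : S → ℂ) (p : S) :
    coeff a b u (a p) (b p) = u p := by
  classical
  rw [coeff, Finset.sum_eq_single p]
  · simp
  · intro q _ hq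
    exact if_neg fun h => hq (hab q p h.1 h.2)
  · simp

theorem norm_sq_coeff (hab : ∀ p q, a p = a q → b p = b q → p = q) (u : S → ℂ) (x : α) (z : β) :
    ‖coeff a b u x z‖ ^ 2 = ∑ p, if a p = x ∧ b p = z then ‖u p‖ ^ 2 else 0 := by
  classical
  by_cases h : ∃ p, a p = x ∧ b p = z
  · obtain ⟨p, rfl, rfl⟩ := h
    rw [coeff_apply hab, Finset.sum_eq_single p]
    · simp
    · intro q _ hq
      exact if_neg fun h => hq (hab q p h.1 h.2)
    · simp
  · push Not at h
    have h' : ∀ p, ¬ (a p = x ∧ b p = z) := fun p hp => h p hp.1 hp.2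
    simp [coeff, h']

theorem sum_mul_norm_sq_coeff (hab : ∀ p q, a p = a q → b p = b q → p = q) {Z : Finset β}
    (hZ : ∀ p, b p ∈ Z) (h : β → ℝ) (u : S → ℂ) (x : α) :
    ∑ z ∈ Z, h z * ‖coeff a b u x z‖ ^ 2 = ∑ p, if a p = x then h (b p) * ‖u p‖ ^ 2 else 0 := by
  simp only [norm_sq_coeff hab, Finset.mul_sum]
  rw [Finset.sum_comm]
  refine Finset.sum_congr rfl fun p _ => ?_
  by_cases hx : a p = x
  · simp [hx, hZ]
  · simp [hx]

/-- Grouping pairs by their common second label `z` writes the partial trace of a rank-one operator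
as a sum of rank-one operators, one for each slice. -/
theorem sum_sum_eq_sum_coeff {Z : Finset β} (hZ : ∀ p, b p ∈ Z) (u : S → ℂ) (x y : α) :
    (∑ p, ∑ q, if a p = x ∧ a q = y ∧ b p = b q then u p * star (u q) else 0) =
      ∑ z ∈ Z, coeff a b u x z * star (coeff a b u y z) := by
  simp only [coeff, star_sum, Finset.sum_mul_sum]
  rw [Finset.sum_comm (s := Z)]
  refine Finset.sum_congr rfl fun p _ => ?_
  rw [Finset.sum_comm (s := Z)]
  refine Finset.sum_congr rfl fun q _ => ?_
  rw [Finset.sum_eq_single (b p)]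
  · by_cases hx : a p = x <;> by_cases hy : a q = y <;> by_cases hb : b p = b q <;>
      simp [hx, hy, hb, eq_comm]
  · intro z _ hz
    simp [hz.symm]
  · intro h
    exact absurd (hZ p) h

/-- The slice of a vector on `S` at the second label `z`, as a linear map. -/
def slice (a : S → α) (b : S → β) (e : X → α) (z : β) : (S → ℂ) →ₗ[ℂ] EuclideanSpace ℂ X where
  toFun u := WithLp.toLp 2 fun x => coeff a b u (e x) z
  map_add' u v := by
    ext x
    simp only [coeff, Pi.add_apply, PiLp.add_apply, ← Finset.sum_add_distrib]
    exact Finset.sum_congr rfl fun p _ => by split_ifs <;> simp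
  map_smul' c u := by
    ext x
    simp only [coeff, Pi.smul_apply, PiLp.smul_apply, Finset.smul_sum, RingHom.id_apply]
    exact Finset.sum_congr rfl fun p _ => by split_ifs <;> simp

@[simp]
theorem slice_apply (e : X → α) (z : β) (u : S → ℂ) (x : X) :
    slice a b e z u x = coeff a b u (e x) z := rfl

variable [Fintype X]

theorem sum_norm_sq_slice (hab : ∀ p q, a p = a q → b p = b q → p = q) {Z : Finset β}
    (hZ : ∀ p, b p ∈ Z) (e : X → α) (u : S → ℂ) :
    ∑ z ∈ Z, ‖slice a b e z u‖ ^ 2 = ∑ p, ∑ x, if a p = e x then ‖u p‖ ^ 2 else 0 := by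
  simp only [EuclideanSpace.norm_sq_eq, slice_apply]
  rw [Finset.sum_comm, Finset.sum_comm (s := (Finset.univ : Finset S))]
  refine Finset.sum_congr rfl fun x _ => ?_
  simpa using sum_mul_norm_sq_coeff hab hZ (fun _ => 1) u (e x)

theorem sum_ite_le {e : X → α} (he : Function.Injective e) (y : α) {t : ℝ} (ht : 0 ≤ t) :
    (∑ x, if y = e x then t else 0) ≤ t := by
  classical
  by_cases h : ∃ x, y = e x
  · obtain ⟨x, rfl⟩ := h
    simp [he.eq_iff]
  · push Not at h
    simp [h, ht]

/-- Pythagoras for the projection onto `v`. It gives the Cauchy–Schwarz bound and also its equality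
case. -/
theorem norm_sq_sub_inner_smul {E : Type*} [NormedAddCommGroup E] [InnerProductSpace ℂ E]
    {v : E} (hv : ‖v‖ = 1) (w : E) :
    ‖w - inner ℂ v w • v‖ ^ 2 = ‖w‖ ^ 2 - ‖inner ℂ v w‖ ^ 2 := by
  rw [@norm_sub_sq ℂ, norm_smul, hv, inner_smul_right, ← inner_conj_symm w v, RCLike.mul_conj]
  norm_cast
  simp
  ring

theorem norm_inner_sq_le {E : Type*} [NormedAddCommGroup E] [InnerProductSpace ℂ E]
    {v : E} (hv : ‖v‖ = 1) (w : E) : ‖inner ℂ v w‖ ^ 2 ≤ ‖w‖ ^ 2 := by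
  have := norm_sq_sub_inner_smul hv w
  nlinarith [sq_nonneg ‖w - inner ℂ v w • v‖]

/-- The overlap of a bipartite vector with a unit vector on the first factor. -/
theorem sum_norm_inner_slice_sq_le (hab : ∀ p q, a p = a q → b p = b q → p = q) {Z : Finset β}
    (hZ : ∀ p, b p ∈ Z) {e : X → α} (he : Function.Injective e) (u : S → ℂ)
    {ψ : EuclideanSpace ℂ X} (hψ : ‖ψ‖ = 1) :
    ∑ z ∈ Z, ‖inner ℂ ψ (slice a b e z u)‖ ^ 2 ≤ ∑ p, ‖u p‖ ^ 2 :=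
  calc _ ≤ ∑ z ∈ Z, ‖slice a b e z u‖ ^ 2 :=
        Finset.sum_le_sum fun _ _ => norm_inner_sq_le hψ _
    _ = ∑ p, ∑ x, if a p = e x then ‖u p‖ ^ 2 else 0 := sum_norm_sq_slice hab hZ e u
    _ ≤ _ := Finset.sum_le_sum fun _ _ => sum_ite_le he _ (sq_nonneg _)

/-- Two inequalities separate the overlap from the full norm: Cauchy–Schwarz in each slice, and the
loss of weight at points whose first label is outside the range of `e`. Equality of the ends forces
equality termwise in both. -/
theorem eq_of_sum_norm_inner_slice_sq_eq (hab : ∀ p q, a p = a q → b p = b q → p = q)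
    {Z : Finset β} (hZ : ∀ p, b p ∈ Z) {e : X → α} (he : Function.Injective e) {u : S → ℂ}
    {ψ : EuclideanSpace ℂ X} (hψ : ‖ψ‖ = 1)
    (h : ∑ z ∈ Z, ‖inner ℂ ψ (slice a b e z u)‖ ^ 2 = ∑ p, ‖u p‖ ^ 2) :
    (∀ z ∈ Z, slice a b e z u = inner ℂ ψ (slice a b e z u) • ψ) ∧
      ∀ p, u p ≠ 0 → ∃ x, a p = e x := by
  have h₁ : ∑ z ∈ Z, ‖inner ℂ ψ (slice a b e z u)‖ ^ 2 ≤ ∑ z ∈ Z, ‖slice a b e z u‖ ^ 2 :=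
    Finset.sum_le_sum fun _ _ => norm_inner_sq_le hψ _
  have h₂ := sum_norm_sq_slice hab hZ e u
  have h₃ : (∑ p, ∑ x, if a p = e x then ‖u p‖ ^ 2 else 0) ≤ ∑ p, ‖u p‖ ^ 2 :=
    Finset.sum_le_sum fun _ _ => sum_ite_le he _ (sq_nonneg _)
  constructor
  · have h₄ := (Finset.sum_eq_sum_iff_of_le fun _ _ => norm_inner_sq_le hψ _).1
      (le_antisymm h₁ (by linarith))
    intro z hz
    have := norm_sq_sub_inner_smul hψ (slice a b e z u)
    rw [h₄ z hz, sub_self] at this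
    exact sub_eq_zero.1 (norm_eq_zero.1 (pow_eq_zero_iff two_ne_zero |>.1 this))
  · have h₄ := (Finset.sum_eq_sum_iff_of_le fun _ _ => sum_ite_le he _ (sq_nonneg _)).1
      (le_antisymm h₃ (by linarith))
    intro p hp
    by_contra! hx
    have := h₄ p (Finset.mem_univ p)
    simp [hx] at this
    exact hp (norm_eq_zero.1 (pow_eq_zero_iff two_ne_zero |>.1 this.symm))

/-- After rescaling to unit vectors, `v` and `f v` are always linearly dependent, which forces `f`
to be a scalar. -/
theorem exists_eq_smul_of_forall_unit {E : Type*} [NormedAddCommGroup E] [NormedSpace ℂ E]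
    (f : E →ₗ[ℂ] E) (h : ∀ v, ‖v‖ = 1 → ∃ c : ℂ, f v = c • v) : ∃ c : ℂ, ∀ v, f v = c • v := by
  have : ∃ c : ℂ, f = c • 1 := by
    refine LinearMap.exists_eq_smul_id_of_forall_notLinearIndependent fun v hv => ?_
    have hv0 : v ≠ 0 := by simpa using hv.ne_zero 0
    rw [LinearIndependent.pair_iff' hv0] at hv
    obtain ⟨c, hc⟩ := h ((‖v‖⁻¹ : ℂ) • v) (by simp [norm_smul, hv0])
    rw [map_smul, smul_comm] at hc
    have hn : (‖v‖⁻¹ : ℂ) ≠ 0 := by simpa using hv0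
    exact hv c (smul_right_injective E hn hc).symm
  obtain ⟨c, rfl⟩ := this
  exact ⟨c, fun v => rfl⟩

/-- If a family of linear maps `U j` sends every unit vector `ψ` to a product of `ψ` and some other
vector, then that other vector does not depend on `ψ`; so the mean values of an additive
observable `g + h` in the images of two basis vectors differ exactly by the difference of `g`. -/
theorem sum_add_mul_norm_sq_eq [DecidableEq X] (hab : ∀ p q, a p = a q → b p = b q → p = q)
    {Z : Finset β} (hZ : ∀ p, b p ∈ Z) {e : X → α} (he : Function.Injective e)
    (U : J → EuclideanSpace ℂ X →ₗ[ℂ] (S → ℂ))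
    (hU : ∀ ψ, ‖ψ‖ = 1 → ∑ j, ∑ p, ‖U j ψ p‖ ^ 2 = 1)
    (hov : ∀ ψ, ‖ψ‖ = 1 → ∑ j, ∑ z ∈ Z, ‖inner ℂ ψ (slice a b e z (U j ψ))‖ ^ 2 = 1)
    (g : α → ℝ) (h : β → ℝ) :
    ∃ c : ℝ, ∀ x, ∑ j, ∑ p, (g (a p) + h (b p)) * ‖U j (EuclideanSpace.single x 1) p‖ ^ 2 =
      g (e x) + c := by
  have hprod : ∀ ψ, ‖ψ‖ = 1 → ∀ j,
      (∀ z ∈ Z, slice a b e z (U j ψ) = inner ℂ ψ (slice a b e z (U j ψ)) • ψ) ∧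
        ∀ p, U j ψ p ≠ 0 → ∃ x, a p = e x := fun ψ hψ j =>
    eq_of_sum_norm_inner_slice_sq_eq hab hZ he hψ <|
      (Finset.sum_eq_sum_iff_of_le fun j _ => sum_norm_inner_slice_sq_le hab hZ he (U j ψ) hψ).1
        ((hov ψ hψ).trans (hU ψ hψ).symm) j (Finset.mem_univ j)
  -- The factor `inner ℂ ψ (slice ..)` seems to depend on `ψ`; linearity of the slice in `ψ` makes
  -- it a constant.
  have hscal : ∀ j, ∀ z : Z, ∃ c : ℂ, ∀ ψ, slice a b e z.1 (U j ψ) = c • ψ := fun j z =>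
    exists_eq_smul_of_forall_unit (slice a b e z.1 ∘ₗ U j) fun ψ hψ =>
      ⟨_, (hprod ψ hψ j).1 z.1 z.2⟩
  choose c hc using hscal
  -- A nonzero value at `p` would put `a p` at some `e y` with `y ≠ x`, but there the slice is a
  -- multiple of the basis vector at `x` and vanishes.
  have hsupp : ∀ j x p, a p ≠ e x → U j (EuclideanSpace.single x 1) p = 0 := by
    intro j x p hp
    by_contra h0
    obtain ⟨y, hy⟩ := (hprod (EuclideanSpace.single x 1) (by simp) j).2 p h0
    have hyx : y ≠ x := fun h' => hp (h' ▸ hy)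
    have := congrArg (fun v : EuclideanSpace ℂ X => v y)
      (hc j ⟨b p, hZ p⟩ (EuclideanSpace.single x 1))
    simp only [slice_apply, ← hy, coeff_apply hab] at this
    exact h0 (by rw [this]; simp [hyx])
  -- The constant is the mean of `h` in the second factors, whose coefficients are the `c j z`.
  refine ⟨∑ j, ∑ z : Z, h z.1 * ‖c j z‖ ^ 2, fun x => ?_⟩
  have h1 : ∀ j, ∑ p, (g (a p) + h (b p)) * ‖U j (EuclideanSpace.single x 1) p‖ ^ 2 =
      g (e x) * ∑ p, ‖U j (EuclideanSpace.single x 1) p‖ ^ 2 + ∑ z : Z, h z.1 * ‖c j z‖ ^ 2 := by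
    intro j
    have h2 : ∑ z : Z, h z.1 * ‖c j z‖ ^ 2 =
        ∑ z ∈ Z, h z * ‖coeff a b (U j (EuclideanSpace.single x 1)) (e x) z‖ ^ 2 := by
      refine (Finset.sum_congr rfl fun z _ => ?_).trans (Finset.sum_coe_sort Z _)
      rw [← slice_apply e, hc j z]
      simp
    rw [h2, sum_mul_norm_sq_coeff hab hZ, Finset.mul_sum, ← Finset.sum_add_distrib]
    refine Finset.sum_congr rfl fun p _ => ?_
    by_cases hp : a p = e x
    · simp [hp, add_mul]
    · simp [hsupp j x p hp]
  simp only [h1]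
  rw [Finset.sum_add_distrib, ← Finset.mul_sum, hU _ (by simp), mul_one]

end Bipartite

theorem Sector.val_injective {M : Type*} [Fintype M] {N : ℕ} :
    Function.Injective fun x : Sector M N => x.1 :=
  Subtype.val_injective

/-! ### The initial ensemble and the overlap as a sum of squares -/

section Purification

variable {G₁ G₂ G₃ G₅ : Type*} [Fintype G₁] [Fintype G₂] [Fintype G₃] [Fintype G₅] {N ν L : ℕ}

theorem occ14_occ235_injective (p q : Fock ((G₁ ⊕ G₂) ⊕ G₃) L × Fock (G₂ ⊕ G₅) L)
    (h : occ14 p = occ14 q) (h' : occ235 p = occ235 q) : p = q := by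
  refine Prod.ext (Subtype.ext (funext fun i => ?_)) (Subtype.ext (funext fun i => ?_))
  · rcases i with (i | i) | i
    · exact congrFun h (Sum.inl i)
    · exact congrFun h' (Sum.inl i)
    · exact congrFun h' (Sum.inr (Sum.inl i))
  · rcases i with i | i
    · exact congrFun h (Sum.inr i)
    · exact congrFun h' (Sum.inr (Sum.inr i))

/-- The joint Fock state with given occupations of `G₁ ⊕ G₂` and of `G₃ ⊕ (G₄ ⊕ G₅)`. -/
def joinOcc (s : Sector (G₁ ⊕ G₂) N × Fock (G₃ ⊕ (G₂ ⊕ G₅)) ν) :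
    Fock ((G₁ ⊕ G₂) ⊕ G₃) (N + ν) × Fock (G₂ ⊕ G₅) (N + ν) :=
  (⟨Sum.elim s.1.1 fun i => s.2.1 (Sum.inl i), by
      have h₁ := s.1.2
      have h₂ := s.2.2
      simp only [total, Fintype.sum_sum_type, Sum.elim_inl, Sum.elim_inr] at *
      omega⟩,
    ⟨fun i => s.2.1 (Sum.inr i), by
      have h₂ := s.2.2
      simp only [total, Fintype.sum_sum_type] at *
      omega⟩)

theorem occ12_joinOcc (s : Sector (G₁ ⊕ G₂) N × Fock (G₃ ⊕ (G₂ ⊕ G₅)) ν) :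
    occ12 (joinOcc s) = s.1.1 := rfl

theorem occ345_joinOcc (s : Sector (G₁ ⊕ G₂) N × Fock (G₃ ⊕ (G₂ ⊕ G₅)) ν) :
    occ345 (joinOcc s) = s.2.1 := by
  ext i
  rcases i with i | i <;> rfl

theorem joinOcc_injective : Function.Injective
    (joinOcc : Sector (G₁ ⊕ G₂) N × Fock (G₃ ⊕ (G₂ ⊕ G₅)) ν → _) := by
  intro s t h
  refine Prod.ext (Subtype.ext ?_) (Subtype.ext ?_)
  · rw [← occ12_joinOcc, h, occ12_joinOcc]
  · rw [← occ345_joinOcc, h, occ345_joinOcc]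

theorem eq_joinOcc (p : Fock ((G₁ ⊕ G₂) ⊕ G₃) (N + ν) × Fock (G₂ ⊕ G₅) (N + ν))
    (h : total (occ12 p) = N) (h' : total (occ345 p) ≤ ν) :
    joinOcc (⟨occ12 p, h⟩, ⟨occ345 p, h'⟩) = p := by
  refine Prod.ext (Subtype.ext (funext fun i => ?_)) (Subtype.ext (funext fun i => rfl))
  rcases i with i | i <;> rfl

theorem amplitude_val (ψ : EuclideanSpace ℂ (Sector (G₁ ⊕ G₂) N)) (x : Sector (G₁ ⊕ G₂) N) :
    amplitude ψ x.1 = ψ x := dif_pos x.2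

/-- Outside the range of `joinOcc` the amplitude or `φ` vanishes, so the joint sum factorizes. -/
theorem sum_norm_sq_amplitude_mul (ψ : EuclideanSpace ℂ (Sector (G₁ ⊕ G₂) N))
    (φ : (G₃ ⊕ (G₂ ⊕ G₅) → ℕ) → ℝ) (hφ : ∀ n, ¬ total n ≤ ν → φ n = 0) :
    ∑ p : Fock ((G₁ ⊕ G₂) ⊕ G₃) (N + ν) × Fock (G₂ ⊕ G₅) (N + ν),
      ‖amplitude ψ (occ12 p)‖ ^ 2 * φ (occ345 p) =
      ‖ψ‖ ^ 2 * ∑ y : Fock (G₃ ⊕ (G₂ ⊕ G₅)) ν, φ y.1 := by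
  rw [EuclideanSpace.norm_sq_eq, Finset.sum_mul_sum, ← Fintype.sum_prod_type']
  refine (Fintype.sum_of_injective joinOcc joinOcc_injective _ _ (fun p hp => ?_)
    fun s => ?_).symm
  · by_cases h : total (occ12 p) = N
    · rw [hφ _ fun h' => hp ⟨_, eq_joinOcc p h h'⟩, mul_zero]
    · simp [amplitude, h]
  · rw [occ12_joinOcc, occ345_joinOcc, amplitude_val]

/-- Extension by zero of a vector of at most `ν` bosons to all occupations. -/
def zeroExt {M : Type*} [Fintype M] (v : Fock M ν → ℂ) (n : M → ℕ) : ℂ :=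
  if h : total n ≤ ν then v ⟨n, h⟩ else 0

theorem zeroExt_val {M : Type*} [Fintype M] (v : Fock M ν → ℂ) (y : Fock M ν) :
    zeroExt v y.1 = v y := dif_pos y.2

theorem entry_sum_vecMulVec {M κ : Type*} [Fintype M] [Fintype κ] (v : κ → Fock M ν → ℂ)
    (n m : M → ℕ) :
    entry (∑ k, Matrix.vecMulVec (v k) (star (v k))) n m =
      ∑ k, zeroExt (v k) n * star (zeroExt (v k) m) := by
  by_cases h : total n ≤ ν ∧ total m ≤ ν
  · simp only [entry, zeroExt, dif_pos h, dif_pos h.1, dif_pos h.2]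
    exact Matrix.sum_apply (⟨n, h.1⟩ : Fock M ν) (⟨m, h.2⟩ : Fock M ν) _ _
  · rw [entry, dif_neg h]
    refine (Finset.sum_eq_zero fun k _ => ?_).symm
    rcases not_and_or.1 h with h | h <;> simp [zeroExt, h]

/-- The joint vector `ψ ⊗ v`, with `ψ` on `G₁ ⊕ G₂` and `v` on `G₃ ⊕ (G₄ ⊕ G₅)`, as a linear
function of `ψ`. -/
def initialVec (v : Fock (G₃ ⊕ (G₂ ⊕ G₅)) ν → ℂ) :
    EuclideanSpace ℂ (Sector (G₁ ⊕ G₂) N) →ₗ[ℂ]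
      (Fock ((G₁ ⊕ G₂) ⊕ G₃) (N + ν) × Fock (G₂ ⊕ G₅) (N + ν) → ℂ) where
  toFun ψ p := amplitude ψ (occ12 p) * zeroExt v (occ345 p)
  map_add' ψ φ := by
    ext p
    by_cases h : total (occ12 p) = N
    · simp only [amplitude, dif_pos h, Pi.add_apply]
      exact add_mul _ _ _
    · simp [amplitude, h]
  map_smul' c ψ := by
    ext p
    by_cases h : total (occ12 p) = N
    · simp only [amplitude, dif_pos h, Pi.smul_apply]
      exact mul_assoc _ _ _
    · simp [amplitude, h]

theorem initialVec_apply (v : Fock (G₃ ⊕ (G₂ ⊕ G₅)) ν → ℂ)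
    (ψ : EuclideanSpace ℂ (Sector (G₁ ⊕ G₂) N)) (p) :
    initialVec v ψ p = amplitude ψ (occ12 p) * zeroExt v (occ345 p) := rfl

theorem initialState_sum_vecMulVec {κ : Type*} [Fintype κ]
    (v : κ → Fock (G₃ ⊕ (G₂ ⊕ G₅)) ν → ℂ) (ψ : EuclideanSpace ℂ (Sector (G₁ ⊕ G₂) N)) :
    initialState ψ (∑ k, Matrix.vecMulVec (v k) (star (v k))) =
      ∑ k, Matrix.vecMulVec (initialVec (v k) ψ) (star (initialVec (v k) ψ)) := by
  ext p q
  simp only [initialState, Matrix.of_apply, entry_sum_vecMulVec, Matrix.sum_apply,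
    Matrix.vecMulVec_apply, Pi.star_apply, initialVec_apply, Finset.mul_sum, star_mul']
  exact Finset.sum_congr rfl fun k _ => by ring

/-- Mean value of a function of the resource occupation in an ensemble of initial vectors. -/
theorem sum_mul_norm_sq_initialVec {κ : Type*} [Fintype κ]
    (v : κ → Fock (G₃ ⊕ (G₂ ⊕ G₅)) ν → ℂ) (ψ : EuclideanSpace ℂ (Sector (G₁ ⊕ G₂) N))
    (d : (G₃ ⊕ (G₂ ⊕ G₅) → ℕ) → ℝ) :
    ∑ k, ∑ p, d (occ345 p) * ‖initialVec (v k) ψ p‖ ^ 2 =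
      ‖ψ‖ ^ 2 * ∑ y : Fock (G₃ ⊕ (G₂ ⊕ G₅)) ν, d y.1 * ∑ k, ‖v k y‖ ^ 2 := by
  have := sum_norm_sq_amplitude_mul (ν := ν) ψ (fun n => d n * ∑ k, ‖zeroExt (v k) n‖ ^ 2)
    (fun n hn => by simp [zeroExt, hn])
  simp only [zeroExt_val] at this
  rw [← this, Finset.sum_comm]
  refine Finset.sum_congr rfl fun p _ => ?_
  simp only [initialVec_apply, norm_mul, mul_pow, Finset.mul_sum]
  exact Finset.sum_congr rfl fun k _ => by ring

theorem initialVec_eq_zero (v : Fock (G₃ ⊕ (G₂ ⊕ G₅)) ν → ℂ)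
    (ψ : EuclideanSpace ℂ (Sector (G₁ ⊕ G₂) N)) {p} (hp : total (occ12 p) ≠ N) :
    initialVec v ψ p = 0 := by
  simp [initialVec_apply, amplitude, hp]

theorem total_alice (p : Fock ((G₁ ⊕ G₂) ⊕ G₃) L × Fock (G₂ ⊕ G₅) L) :
    total p.1.1 = total (occ12 p) + ∑ i, occ345 p (Sum.inl i) := by
  simp [total, occ12, occ345, Fintype.sum_sum_type]

/-- The occupations of `G₂ ⊕ (G₃ ⊕ G₅)` that occur in joint Fock states. -/
noncomputable def tracedOccs (G₁ G₂ G₃ G₅ : Type*) [Fintype G₁] [Fintype G₂] [Fintype G₃] [Fintype G₅]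
    (L : ℕ) : Finset (G₂ ⊕ (G₃ ⊕ G₅) → ℕ) :=
  Finset.univ.image fun p : Fock ((G₁ ⊕ G₂) ⊕ G₃) L × Fock (G₂ ⊕ G₅) L => occ235 p

theorem occ235_mem_tracedOccs (p : Fock ((G₁ ⊕ G₂) ⊕ G₃) L × Fock (G₂ ⊕ G₅) L) :
    occ235 p ∈ tracedOccs G₁ G₂ G₃ G₅ L :=
  Finset.mem_image_of_mem _ (Finset.mem_univ p)

theorem reduced14_sum_vecMulVec {J : Type*} [Fintype J]
    (u : J → Fock ((G₁ ⊕ G₂) ⊕ G₃) L × Fock (G₂ ⊕ G₅) L → ℂ) (x y : G₁ ⊕ G₂ → ℕ) :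
    reduced14 (∑ j, Matrix.vecMulVec (u j) (star (u j))) x y =
      ∑ j, ∑ z ∈ tracedOccs G₁ G₂ G₃ G₅ L,
        coeff occ14 occ235 (u j) x z * star (coeff occ14 occ235 (u j) y z) := by
  have h : ∀ j, _ := fun j => sum_sum_eq_sum_coeff (a := occ14) (b := occ235)
    (Z := tracedOccs G₁ G₂ G₃ G₅ L) occ235_mem_tracedOccs
    (u j) x y
  simp only [← h]
  rw [Finset.sum_comm, reduced14]
  refine Finset.sum_congr rfl fun p _ => ?_
  rw [Finset.sum_comm]
  refine Finset.sum_congr rfl fun q _ => ?_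
  split_ifs
  · simp [Matrix.sum_apply, Matrix.vecMulVec_apply]
  · simp

theorem re_sum_star_mul_reduced14 {J : Type*} [Fintype J]
    (u : J → Fock ((G₁ ⊕ G₂) ⊕ G₃) L × Fock (G₂ ⊕ G₅) L → ℂ)
    (ψ : EuclideanSpace ℂ (Sector (G₁ ⊕ G₂) N)) :
    (∑ x : Sector (G₁ ⊕ G₂) N, ∑ y : Sector (G₁ ⊕ G₂) N,
      star (ψ x) * reduced14 (∑ j, Matrix.vecMulVec (u j) (star (u j))) x.1 y.1 * ψ y).re =
      ∑ j, ∑ z ∈ tracedOccs G₁ G₂ G₃ G₅ L,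
        ‖inner ℂ ψ (slice occ14 occ235 (fun x : Sector (G₁ ⊕ G₂) N => x.1) z (u j))‖ ^ 2 := by
  rw [← Complex.ofReal_re (∑ j, _)]
  congr 1
  simp only [reduced14_sum_vecMulVec, Complex.ofReal_sum, Complex.ofReal_pow]
  simp only [Finset.mul_sum, Finset.sum_mul]
  have hz : ∀ j z, ((‖inner ℂ ψ (slice occ14 occ235
      (fun x : Sector (G₁ ⊕ G₂) N => x.1) z (u j))‖ : ℂ) ^ 2) =
      ∑ x : Sector (G₁ ⊕ G₂) N, ∑ y : Sector (G₁ ⊕ G₂) N, star (ψ x) *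
        (coeff occ14 occ235 (u j) x.1 z * star (coeff occ14 occ235 (u j) y.1 z)) * ψ y := by
    intro j z
    rw [← Complex.mul_conj', PiLp.inner_apply, map_sum, Finset.sum_mul_sum]
    refine Finset.sum_congr rfl fun x _ => Finset.sum_congr rfl fun y _ => ?_
    simp
    ring
  simp only [hz]
  calc _ = ∑ x : Sector (G₁ ⊕ G₂) N, ∑ j, ∑ y : Sector (G₁ ⊕ G₂) N,
        ∑ z ∈ tracedOccs G₁ G₂ G₃ G₅ L, star (ψ x) *
        (coeff occ14 occ235 (u j) x.1 z * star (coeff occ14 occ235 (u j) y.1 z)) * ψ y :=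
        Finset.sum_congr rfl fun x _ => Finset.sum_comm
    _ = _ := by
      rw [Finset.sum_comm]
      refine Finset.sum_congr rfl fun j _ => ?_
      rw [Finset.sum_comm (s := tracedOccs G₁ G₂ G₃ G₅ L)]
      exact Finset.sum_congr rfl fun x _ => Finset.sum_comm

/-- The overlap of a protocol in terms of finitely many vectors that depend linearly on the
teleported vector; the mean particle number of Alice in them does not depend on that vector. -/
theorem exists_overlap_eq {ρ : Op (G₃ ⊕ (G₂ ⊕ G₅)) ν} (hρ : IsState ρ)
    (P : LOCC ((G₁ ⊕ G₂) ⊕ G₃) (G₂ ⊕ G₅) (N + ν)) :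
    ∃ (J : Type) (_ : Fintype J) (U : J → EuclideanSpace ℂ (Sector (G₁ ⊕ G₂) N) →ₗ[ℂ]
        (Fock ((G₁ ⊕ G₂) ⊕ G₃) (N + ν) × Fock (G₂ ⊕ G₅) (N + ν) → ℂ)),
      (∀ ψ, overlap ρ P ψ = ∑ j, ∑ z ∈ tracedOccs G₁ G₂ G₃ G₅ (N + ν),
        ‖inner ℂ ψ (slice occ14 occ235 (fun x : Sector (G₁ ⊕ G₂) N => x.1) z (U j ψ))‖ ^ 2) ∧
      (∀ ψ, ‖ψ‖ = 1 → ∑ j, ∑ p, ‖U j ψ p‖ ^ 2 = 1) ∧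
      ∃ m : ℝ, ∀ ψ, ‖ψ‖ = 1 → ∑ j, ∑ p, (total p.1.1 : ℝ) * ‖U j ψ p‖ ^ 2 = m := by
  obtain ⟨ι, _, K, hcomm, hcompl, hrun⟩ := P.exists_kraus
  obtain ⟨r, v, hv⟩ := Matrix.posSemidef_iff_eq_sum_vecMulVec.1 hρ.posSemidef
  have hcons : ∀ (d : Fock ((G₁ ⊕ G₂) ⊕ G₃) (N + ν) × Fock (G₂ ⊕ G₅) (N + ν) → ℝ)
      (d' : (G₃ ⊕ (G₂ ⊕ G₅) → ℕ) → ℝ)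
      (_ : ∀ i, Commute (K i) (Matrix.diagonal fun p => (d p : ℂ)))
      (_ : ∀ p, total (occ12 p) = N → d p = d' (occ345 p)), ∀ ψ, ‖ψ‖ = 1 →
      ∑ j : ι × Fin r, ∑ p, d p * ‖((K j.1).mulVecLin ∘ₗ initialVec (v j.2)) ψ p‖ ^ 2 =
        ∑ y : Fock (G₃ ⊕ (G₂ ⊕ G₅)) ν, d' y.1 * ∑ k, ‖v k y‖ ^ 2 := by
    intro d d' hd hdd' ψ hψ
    -- With `k` fixed, the sum over all Kraus operators acts on the single initial vector of `v k`,
    -- so conservation applies to each `k` separately.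
    rw [Fintype.sum_prod_type, Finset.sum_comm]
    simp only [LinearMap.comp_apply, Matrix.mulVecLin_apply]
    simp only [sum_mul_norm_sq_mulVec K hcompl d hd]
    have h := sum_mul_norm_sq_initialVec (N := N) v ψ d'
    rw [hψ, one_pow, one_mul] at h
    rw [← h]
    refine Finset.sum_congr rfl fun k _ => Finset.sum_congr rfl fun p _ => ?_
    by_cases hp : total (occ12 p) = N
    · rw [hdd' p hp]
    · simp [initialVec_eq_zero _ _ hp]
  refine ⟨ι × Fin r, inferInstance,
    fun j => (K j.1).mulVecLin ∘ₗ initialVec (v j.2), fun ψ => ?_, ?_, ?_⟩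
  · rw [← re_sum_star_mul_reduced14, overlap, hrun, hv, initialState_sum_vecMulVec,
      Fintype.sum_prod_type]
    simp only [Finset.mul_sum, Finset.sum_mul, Matrix.mul_vecMulVec, Matrix.vecMulVec_mul,
      LinearMap.comp_apply, Matrix.mulVecLin_apply, Matrix.star_mulVec]
  · intro ψ hψ
    have h := hcons (fun _ => 1) (fun _ => 1) (fun i => by simp) (fun _ _ => rfl) ψ hψ
    simp only [one_mul] at h
    rw [h, ← Complex.ofReal_inj, Complex.ofReal_one, ← hρ.trace_eq_one, hv]
    simp [Matrix.trace, Matrix.sum_apply, Matrix.vecMulVec_apply, Complex.mul_conj']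
  -- On the support of the initial vectors `G₁ ⊕ G₂` holds exactly `N` bosons, so Alice's number
  -- depends only on the resource occupation.
  · refine ⟨_, hcons (fun p => (total p.1.1 : ℝ)) (fun n => N + ∑ i, (n (Sum.inl i) : ℝ))
      (fun i => ?_) (fun p hp => ?_)⟩
    · convert hcomm i using 1
      ext p q
      rw [Matrix.kroneckerMap_apply, numberOp]
      by_cases h₁ : p.1 = q.1 <;> by_cases h₂ : p.2 = q.2 <;>
        simp [Matrix.diagonal_apply, Matrix.one_apply, Prod.ext_iff, h₁, h₂]
    · rw [total_alice, hp]
      push_cast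
      rfl

end Purification

/-- Fock state with all `N` bosons in one mode. -/
theorem total_single {M : Type*} [Fintype M] [DecidableEq M] (i : M) (N : ℕ) :
    total (Pi.single i N) = N := by
  simp [total]

/-! ### Continuity of the overlap, its bound, and strictness at some vector -/

section Overlap

variable {G₁ G₂ G₃ G₅ : Type*} [Fintype G₁] [Fintype G₂] [Fintype G₃] [Fintype G₅] {N ν : ℕ}

theorem continuous_overlap {ρ : Op (G₃ ⊕ (G₂ ⊕ G₅)) ν} (hρ : IsState ρ)
    (P : LOCC ((G₁ ⊕ G₂) ⊕ G₃) (G₂ ⊕ G₅) (N + ν)) : Continuous (overlap ρ P) := by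
  obtain ⟨J, _, U, hov, -, -⟩ := exists_overlap_eq hρ P
  rw [funext hov]
  refine continuous_finsetSum _ fun j _ => continuous_finsetSum _ fun z _ => ?_
  refine (Continuous.norm ?_).pow 2
  exact continuous_id.inner
    (LinearMap.continuous_of_finiteDimensional (slice occ14 occ235 _ z ∘ₗ U j))

theorem overlap_le_one {ρ : Op (G₃ ⊕ (G₂ ⊕ G₅)) ν} (hρ : IsState ρ)
    (P : LOCC ((G₁ ⊕ G₂) ⊕ G₃) (G₂ ⊕ G₅) (N + ν)) {ψ : EuclideanSpace ℂ (Sector (G₁ ⊕ G₂) N)}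
    (hψ : ‖ψ‖ = 1) : overlap ρ P ψ ≤ 1 := by
  obtain ⟨J, _, U, hov, hU, -⟩ := exists_overlap_eq hρ P
  rw [hov, ← hU ψ hψ]
  exact Finset.sum_le_sum fun j _ => sum_norm_inner_slice_sq_le occ14_occ235_injective
    occ235_mem_tracedOccs Sector.val_injective _ hψ

theorem exists_overlap_ne_one [Nonempty G₁] [Nonempty G₂] (hN : 1 ≤ N)
    {ρ : Op (G₃ ⊕ (G₂ ⊕ G₅)) ν} (hρ : IsState ρ)
    (P : LOCC ((G₁ ⊕ G₂) ⊕ G₃) (G₂ ⊕ G₅) (N + ν)) :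
    ∃ ψ, ‖ψ‖ = 1 ∧ overlap ρ P ψ ≠ 1 := by
  classical
  by_contra! hall
  obtain ⟨J, _, U, hov, hU, m, hm⟩ := exists_overlap_eq hρ P
  -- Alice's number splits as the `G₁` part, seen by the first label, plus the `G₂` and `G₃` parts,
  -- seen by the traced label.
  obtain ⟨c, hc⟩ := sum_add_mul_norm_sq_eq occ14_occ235_injective
    occ235_mem_tracedOccs
    (e := fun x : Sector (G₁ ⊕ G₂) N => x.1) Sector.val_injective U hU
    (fun ψ hψ => (hov ψ).symm.trans (hall ψ hψ))
    (fun x => ∑ i, (x (Sum.inl i) : ℝ))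
    (fun z => ∑ i, (z (Sum.inl i) : ℝ) + ∑ i, (z (Sum.inr (Sum.inl i)) : ℝ))
  have hg : ∀ x : Sector (G₁ ⊕ G₂) N, ∑ i, (x.1 (Sum.inl i) : ℝ) + c = m := by
    intro x
    rw [← hc x, ← hm (EuclideanSpace.single x 1) (by simp)]
    refine Finset.sum_congr rfl fun j _ => Finset.sum_congr rfl fun p _ => ?_
    congr 1
    simp [total, occ14, occ235, Fintype.sum_sum_type, add_assoc]
  obtain ⟨i₁⟩ := ‹Nonempty G₁›
  obtain ⟨i₂⟩ := ‹Nonempty G₂›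
  -- These two basis states hold `N` and `0` bosons in `G₁`.
  have h₁ := hg ⟨Pi.single (Sum.inl i₁) N, total_single _ _⟩
  have h₂ := hg ⟨Pi.single (Sum.inr i₂) N, total_single _ _⟩
  simp [Pi.single_apply] at h₁ h₂
  have : (N : ℝ) = 0 := by linarith
  have : N = 0 := by exact_mod_cast this
  omega

end Overlap

/-! ### The uniform measure and the average fidelity -/

theorem isProbabilityMeasure_uniform (M : Type*) [Fintype M] (N : ℕ) [Nonempty (Sector M N)] :
    IsProbabilityMeasure (uniform M N) := by
  refine ⟨?_⟩
  rw [uniform, Measure.smul_apply, smul_eq_mul]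
  refine ENNReal.inv_mul_cancel ?_ (measure_ne_top _ _)
  rw [Measure.measure_univ_ne_zero]
  exact Measure.toSphere_ne_zero _

/-- This lets a strict inequality at one vector survive averaging. -/
theorem isOpenPosMeasure_uniform (M : Type*) [Fintype M] (N : ℕ) :
    (uniform M N).IsOpenPosMeasure :=
  ⟨fun U hU hne => by
    rw [uniform, Measure.smul_apply, smul_eq_mul]
    exact mul_ne_zero (ENNReal.inv_ne_zero.2 (measure_ne_top _ _)) (hU.measure_ne_zero _ hne)⟩

end BosonTeleport

theorem proposition2 {G₁ G₂ G₃ G₅ : Type*} [Fintype G₁] [Fintype G₂] [Fintype G₃] [Fintype G₅]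
    [Nonempty G₁] [Nonempty G₂] {N ν : ℕ} (hN : 1 ≤ N)
    (ρ : BosonTeleport.Op (G₃ ⊕ (G₂ ⊕ G₅)) ν) (hρ : BosonTeleport.IsState ρ)
    (P : BosonTeleport.LOCC ((G₁ ⊕ G₂) ⊕ G₃) (G₂ ⊕ G₅) (N + ν)) :
    MeasureTheory.Integrable (fun ψ => BosonTeleport.overlap ρ P ψ.1)
        (BosonTeleport.uniform (G₁ ⊕ G₂) N) ∧
      BosonTeleport.fidelity ρ P < 1 := by
  classical
  have : Nonempty (BosonTeleport.Sector (G₁ ⊕ G₂) N) :=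
    ⟨⟨Pi.single (Sum.inl (Classical.arbitrary G₁)) N, BosonTeleport.total_single _ _⟩⟩
  have := BosonTeleport.isProbabilityMeasure_uniform (G₁ ⊕ G₂) N
  have := BosonTeleport.isOpenPosMeasure_uniform (G₁ ⊕ G₂) N
  have hcont : Continuous fun ψ : Metric.sphere
      (0 : EuclideanSpace ℂ (BosonTeleport.Sector (G₁ ⊕ G₂) N)) 1 =>
      BosonTeleport.overlap ρ P ψ.1 :=
    (BosonTeleport.continuous_overlap hρ P).comp continuous_subtype_val
  have hint : Integrable (fun ψ => BosonTeleport.overlap ρ P ψ.1)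
      (BosonTeleport.uniform (G₁ ⊕ G₂) N) :=
    hcont.integrable_of_hasCompactSupport (HasCompactSupport.of_compactSpace _)
  refine ⟨hint, ?_⟩
  obtain ⟨ψ, hψ, hne⟩ := BosonTeleport.exists_overlap_ne_one hN hρ P
  -- Applied to one minus the overlap, which is continuous, nonnegative and nonzero at `ψ`.
  have hpos := Continuous.integral_pos_of_hasCompactSupport_nonneg_nonzero
    (μ := BosonTeleport.uniform (G₁ ⊕ G₂) N) (x := ⟨ψ, by simpa using hψ⟩)
    (continuous_const.sub hcont) (HasCompactSupport.of_compactSpace _)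
    (fun φ => sub_nonneg.2 (BosonTeleport.overlap_le_one hρ P (by simp)))
    (sub_ne_zero.2 hne.symm)
  simp only [Pi.sub_apply] at hpos
  rw [integral_sub (integrable_const _) hint] at hpos
  simpa [BosonTeleport.fidelity] using hpos
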